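/- Let $\mathbb F$ be a field with $\operatorname{char}\mathbb F\neq 2$. Write $[x,y]=xy-yx$ and $\{x,y\}=xy+yx$; algebras are associative and unital. Let $\Re$ be the $\mathbb F$-algebra (the Racah algebra) with generators $A,B,C,D$ and relations asserting that $[A,B]=[B,C]=[C,A]=2D$ and that each of $$\alpha=[A,D]+AC-BA,\qquad \beta=[B,D]+BA-CB,\qquad \gamma=[C,D]+CB-AC$$ is central in $\Re$. Put $\delta=A+B+C$ and let $\mathfrak C$ be the $\mathbb F$-subalgebra of $\Re$ generated by $\alpha,\beta,\gamma,\delta$. A Casimir element of $\Re$ is an element of the coset $$D^2+A^2+B^2+\frac{(\delta+2)\{A,B\}-\{A^2,B\}-\{A,B^2\}}{2}+A(\beta-\delta)-B(\delta+\alpha)+\mathfrak C .$$ Let $\mathfrak{BI}$ be the $\mathbb F$-algebra (the Bannai–Ito algebra) with generators $X,Y,Z$ and relations asserting that each of $$\kappa=\{X,Y\}-Z,\qquad \lambda=\{Y,Z\}-X,\qquad \mu=\{Z,X\}-Y$$ is central in $\mathfrak{BI}$, and put $\iota=X+Y+Z$. Let $\zeta\colon\Re\to\mathfrak{BI}$ be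 the $\mathbb F$-algebra homomorphism with $$A\mapsto\frac{(2X-3)(2X+1)}{16},\qquad B\mapsto\frac{(2Y-3)(2Y+1)}{16},\qquad C\mapsto\frac{(2Z-3)(2Z+1)}{16}.$$ Then for every Casimir element $\Omega$ of $\Re$ there is a unique polynomial $P(x_1,x_2,x_3,x_4)$ in four commuting variables over $\mathbb F$ such that $$\zeta(\Omega)=P(\iota,\kappa,\lambda,\mu)\quad\text{in }\mathfrak{BI}.$$ -/

import Mathlib

/-! ## The Racah algebra -/

/-- The four generators of the Racah algebra. -/
inductive RacahGen : Type
  | A | B | C | D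

namespace RacahGen

/-- A generator as an element of the free algebra. -/
abbrev free (F : Type*) [Field F] (g : RacahGen) : FreeAlgebra F RacahGen :=
  FreeAlgebra.ι F g

end RacahGen

open RacahGen in
/-- The defining relations of the Racah algebra: `[A,B] = [B,C] = [C,A] = 2D`, and each of
`[A,D] + AC - BA`, `[B,D] + BA - CB`, `[C,D] + CB - AC` commutes with every element. -/
inductive RacahRel (F : Type*) [Field F] :
    FreeAlgebra F RacahGen → FreeAlgebra F RacahGen → Prop
  | comm_AB : RacahRel F (free F A * free F B - free F B * free F A) (2 * free F D)
  | comm_BC : RacahRel F (free F B * free F C - free F C * free F B) (2 * free F D)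
  | comm_CA : RacahRel F (free F C * free F A - free F A * free F C) (2 * free F D)
  | central_alpha (w : FreeAlgebra F RacahGen) : RacahRel F
      (((free F A * free F D - free F D * free F A)
        + free F A * free F C - free F B * free F A) * w)
      (w * ((free F A * free F D - free F D * free F A)
        + free F A * free F C - free F B * free F A))
  | central_beta (w : FreeAlgebra F RacahGen) : RacahRel F
      (((free F B * free F D - free F D * free F B)
        + free F B * free F A - free F C * free F B) * w)
      (w * ((free F B * free F D - free F D * free F B)
        + free F B * free F A - free F C * free F B))
  | central_gamma (w : FreeAlgebra F RacahGen) : RacahRel F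
      (((free F C * free F D - free F D * free F C)
        + free F C * free F B - free F A * free F C) * w)
      (w * ((free F C * free F D - free F D * free F C)
        + free F C * free F B - free F A * free F C))

/-- The Racah algebra over `F`: generators `A, B, C, D` modulo the Racah relations. -/
abbrev RacahAlgebra (F : Type*) [Field F] : Type _ := RingQuot (RacahRel F)

namespace RacahAlgebra

variable (F : Type*) [Field F]

/-- The image in the Racah algebra of a generator. -/
noncomputable def gen (g : RacahGen) : RacahAlgebra F :=
  RingQuot.mkAlgHom F (RacahRel F) (FreeAlgebra.ι F g)

noncomputable def A : RacahAlgebra F := gen F RacahGen.A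
noncomputable def B : RacahAlgebra F := gen F RacahGen.B
noncomputable def C : RacahAlgebra F := gen F RacahGen.C
noncomputable def D : RacahAlgebra F := gen F RacahGen.D

/-- `α = [A,D] + AC - BA`. -/
noncomputable def alpha : RacahAlgebra F := (A F * D F - D F * A F) + A F * C F - B F * A F
/-- `β = [B,D] + BA - CB`. -/
noncomputable def beta : RacahAlgebra F := (B F * D F - D F * B F) + B F * A F - C F * B F
/-- `γ = [C,D] + CB - AC`. -/
noncomputable def gamma : RacahAlgebra F := (C F * D F - D F * C F) + C F * B F - A F * C F
/-- `δ = A + B + C`. -/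
noncomputable def delta : RacahAlgebra F := A F + B F + C F

/-- The subalgebra generated by `α, β, γ, δ`. -/
noncomputable def centralSubalgebra : Subalgebra F (RacahAlgebra F) :=
  Algebra.adjoin F {alpha F, beta F, gamma F, delta F}

/-- The representative
`D² + A² + B² + ((δ+2){A,B} - {A²,B} - {A,B²})/2 + A(β-δ) - B(δ+α)` of the Casimir class. -/
noncomputable def casimirBase : RacahAlgebra F :=
  D F ^ 2 + A F ^ 2 + B F ^ 2
    + (2 : F)⁻¹ • ((delta F + 2) * (A F * B F + B F * A F)
        - (A F ^ 2 * B F + B F * A F ^ 2) - (A F * B F ^ 2 + B F ^ 2 * A F))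
    + A F * (beta F - delta F) - B F * (delta F + alpha F)

/-- A Casimir element: a member of the coset `casimirBase + centralSubalgebra`. -/
def IsCasimir {F : Type*} [Field F] (Ω : RacahAlgebra F) : Prop :=
  ∃ c ∈ centralSubalgebra F, Ω = casimirBase F + c

end RacahAlgebra

/-! ## The Bannai-Ito algebra -/

/-- The three generators of the Bannai-Ito algebra. -/
inductive BIGen : Type
  | X | Y | Z

namespace BIGen

/-- A generator as an element of the free algebra. -/
abbrev free (F : Type*) [Field F] (g : BIGen) : FreeAlgebra F BIGen :=
  FreeAlgebra.ι F g

end BIGen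

open BIGen in
/-- The defining relations of the Bannai-Ito algebra: each of `{X,Y} - Z`, `{Y,Z} - X`,
`{Z,X} - Y` commutes with every element. -/
inductive BIRel (F : Type*) [Field F] : FreeAlgebra F BIGen → FreeAlgebra F BIGen → Prop
  | central_kappa (w : FreeAlgebra F BIGen) : BIRel F
      (((free F X * free F Y + free F Y * free F X) - free F Z) * w)
      (w * ((free F X * free F Y + free F Y * free F X) - free F Z))
  | central_lam (w : FreeAlgebra F BIGen) : BIRel F
      (((free F Y * free F Z + free F Z * free F Y) - free F X) * w)
      (w * ((free F Y * free F Z + free F Z * free F Y) - free F X))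
  | central_mu (w : FreeAlgebra F BIGen) : BIRel F
      (((free F Z * free F X + free F X * free F Z) - free F Y) * w)
      (w * ((free F Z * free F X + free F X * free F Z) - free F Y))

/-- The Bannai-Ito algebra over `F`: generators `X, Y, Z` modulo the Bannai-Ito relations. -/
abbrev BIAlgebra (F : Type*) [Field F] : Type _ := RingQuot (BIRel F)

namespace BIAlgebra

variable (F : Type*) [Field F]

/-- The image in the Bannai-Ito algebra of a generator. -/
noncomputable def gen (g : BIGen) : BIAlgebra F :=
  RingQuot.mkAlgHom F (BIRel F) (FreeAlgebra.ι F g)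

noncomputable def X : BIAlgebra F := gen F BIGen.X
noncomputable def Y : BIAlgebra F := gen F BIGen.Y
noncomputable def Z : BIAlgebra F := gen F BIGen.Z

/-- `ι = X + Y + Z`. -/
noncomputable def iota : BIAlgebra F := X F + Y F + Z F
/-- `κ = {X,Y} - Z`. -/
noncomputable def kappa : BIAlgebra F := (X F * Y F + Y F * X F) - Z F
/-- `λ = {Y,Z} - X`. -/
noncomputable def lam : BIAlgebra F := (Y F * Z F + Z F * Y F) - X F
/-- `μ = {Z,X} - Y`. -/
noncomputable def mu : BIAlgebra F := (Z F * X F + X F * Z F) - Y F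

theorem kappa_central (w : BIAlgebra F) : kappa F * w = w * kappa F := by
  obtain ⟨w, rfl⟩ := RingQuot.mkAlgHom_surjective F (BIRel F) w
  simpa [kappa, X, Y, Z, gen] using RingQuot.mkAlgHom_rel F (BIRel.central_kappa w)

theorem lam_central (w : BIAlgebra F) : lam F * w = w * lam F := by
  obtain ⟨w, rfl⟩ := RingQuot.mkAlgHom_surjective F (BIRel F) w
  simpa [lam, X, Y, Z, gen] using RingQuot.mkAlgHom_rel F (BIRel.central_lam w)

theorem mu_central (w : BIAlgebra F) : mu F * w = w * mu F := by
  obtain ⟨w, rfl⟩ := RingQuot.mkAlgHom_surjective F (BIRel F) w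
  simpa [mu, X, Y, Z, gen] using RingQuot.mkAlgHom_rel F (BIRel.central_mu w)

end BIAlgebra

/-! ## Polynomials in four commuting elements of an algebra -/

/-- The value `P(a₀, a₁, a₂, a₃)` of a polynomial in four variables, for elements that commute
with one another (so that the order of the factors is irrelevant). -/
noncomputable def evalFour {F R : Type*} [Field F] [Ring R] [Algebra F R]
    (P : MvPolynomial (Fin 4) F) (a₀ a₁ a₂ a₃ : R) : R :=
  ∑ m ∈ P.support, P.coeff m • (a₀ ^ m 0 * a₁ ^ m 1 * a₂ ^ m 2 * a₃ ^ m 3)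

/-! ## The homomorphism from the Racah algebra to the Bannai-Ito algebra -/

set_option linter.unusedSimpArgs false in
/-- Identities in a ring with elements `x, y, z` such that `{x,y} - z = k`, `{y,z} - x = l`,
`{z,x} - y = m` commute with `x, y, z`; here `a = (2x-3)(2x+1)`, `b = (2y-3)(2y+1)`,
`c = (2z-3)(2z+1)`. -/
theorem bi_identities {R : Type*} [Ring R] (x y z k l m : R)
    (hk : x * y + y * x - z = k) (hl : y * z + z * y - x = l) (hm : z * x + x * z - y = m)
    (kx : k * x = x * k) (ky : k * y = y * k) (kz : k * z = z * k)
    (lx : l * x = x * l) (ly : l * y = y * l) (lz : l * z = z * l)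
    (mx : m * x = x * m) (my : m * y = y * m) (mz : m * z = z * m)
    (a b c d i : R) (ha : a = (2 * x - 3) * (2 * x + 1)) (hb : b = (2 * y - 3) * (2 * y + 1))
    (hc : c = (2 * z - 3) * (2 * z + 1)) (hi : i = x + y + z) (hd : d = a * b - b * a) :
    b * c - c * b = d ∧ i * a = a * i ∧
      (a * d - d * a) + 32 * (a * c - b * a) = 128 * ((2 * i - k - m - 3) * (k - m)) := by
  have hyx : y * x = z + k - x * y := by rw [← hk]; abel
  have hzy : z * y = x + l - y * z := by rw [← hl]; abel
  have hzx : z * x = y + m - x * z := by rw [← hm]; abel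
  have lk : l * k = k * l := by
    have h1 : l * (x * y) = (x * y) * l := by rw [← mul_assoc, lx, mul_assoc, ly, mul_assoc]
    have h2 : l * (y * x) = (y * x) * l := by rw [← mul_assoc, ly, mul_assoc, lx, mul_assoc]
    rw [← hk]; simp only [mul_sub, sub_mul, mul_add, add_mul, h1, h2, lz]
  have mk : m * k = k * m := by
    have h1 : m * (x * y) = (x * y) * m := by rw [← mul_assoc, mx, mul_assoc, my, mul_assoc]
    have h2 : m * (y * x) = (y * x) * m := by rw [← mul_assoc, my, mul_assoc, mx, mul_assoc]
    rw [← hk]; simp only [mul_sub, sub_mul, mul_add, add_mul, h1, h2, mz]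
  have ml : m * l = l * m := by
    have h1 : m * (y * z) = (y * z) * m := by rw [← mul_assoc, my, mul_assoc, mz, mul_assoc]
    have h2 : m * (z * y) = (z * y) * m := by rw [← mul_assoc, mz, mul_assoc, my, mul_assoc]
    rw [← hl]; simp only [mul_sub, sub_mul, mul_add, add_mul, h1, h2, mx]
  have ext : ∀ {p q r : R}, p * q = r → ∀ w, p * (q * w) = r * w := by
    rintro p q _ rfl w; exact (mul_assoc p q w).symm
  obtain ⟨u, hu⟩ : ∃ u, u = x * x - x := ⟨_, rfl⟩
  obtain ⟨v, hv⟩ : ∃ v, v = y * y - y := ⟨_, rfl⟩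
  obtain ⟨w, hw⟩ : ∃ w, w = z * z - z := ⟨_, rfl⟩
  have poly : ∀ t : R, (2 * t - 3) * (2 * t + 1) = 4 • (t * t - t) - 3 • 1 := by
    intro t
    have h3 : (3 : R) = 3 • 1 := by norm_num
    rw [h3]; noncomm_ring
  have ha' : a = 4 • u - 3 • 1 := by rw [ha, hu, poly]
  have hb' : b = 4 • v - 3 • 1 := by rw [hb, hv, poly]
  have hc' : c = 4 • w - 3 • 1 := by rw [hc, hw, poly]
  have e1 : v * w - w * v = u * v - v * u := by
    subst hu hv hw
    simp only [mul_sub, sub_mul, mul_add, add_mul, mul_assoc, hyx, hzy, hzx, ext hyx, ext hzy,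
      ext hzx, kx, ky, kz, lx, ly, lz, mx, my, mz, ext kx, ext ky, ext kz, ext lx, ext ly, ext lz,
      ext mx, ext my, ext mz, lk, mk, ml, ext lk, ext mk, ext ml]
    abel
  have e2 : i * u = u * i := by
    subst hu hi
    simp only [mul_sub, sub_mul, mul_add, add_mul, mul_assoc, hyx, hzy, hzx, ext hyx, ext hzy,
      ext hzx, kx, ky, kz, lx, ly, lz, mx, my, mz, ext kx, ext ky, ext kz, ext lx, ext ly, ext lz,
      ext mx, ext my, ext mz, lk, mk, ml, ext lk, ext mk, ext ml]
    abel
  have e3 : (u * (u * v - v * u) - (u * v - v * u) * u) + 8 • (u * w - v * u) - 6 • (w - v)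
      = 2 • ((i + i - k - m) * (k - m)) - 6 • (k - m) := by
    subst hu hv hw hi
    simp only [mul_sub, sub_mul, mul_add, add_mul, mul_assoc, hyx, hzy, hzx, ext hyx, ext hzy,
      ext hzx, kx, ky, kz, lx, ly, lz, mx, my, mz, ext kx, ext ky, ext kz, ext lx, ext ly, ext lz,
      ext mx, ext my, ext mz, lk, mk, ml, ext lk, ext mk, ext ml]
    abel
  have hd' : d = 16 • (u * v - v * u) := by rw [hd, ha', hb']; noncomm_ring
  refine ⟨?_, ?_, ?_⟩
  · rw [hd', ← e1, hb', hc']; noncomm_ring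
  · rw [ha', mul_sub, sub_mul, mul_smul_comm, smul_mul_assoc, e2,
      mul_smul_comm, smul_mul_assoc, one_mul, mul_one]
  · have h : (a * d - d * a) + 32 * (a * c - b * a) = 64 • ((u * (u * v - v * u)
        - (u * v - v * u) * u) + 8 • (u * w - v * u) - 6 • (w - v)) := by
      rw [hd', ha', hb', hc']; noncomm_ring
    have h3 : (3 : R) = 3 • 1 := by norm_num
    rw [h, e3, h3]; noncomm_ring

/-- The identities above, rescaled, with `A = a/16`, `B = b/16`, `C = c/16`, `D = [A,B]/2`. -/
theorem bi_identities_scaled {F R : Type*} [Field F] (h2 : (2 : F) ≠ 0) [Ring R] [Algebra F R]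
    (x y z k l m : R)
    (hk : x * y + y * x - z = k) (hl : y * z + z * y - x = l) (hm : z * x + x * z - y = m)
    (kc : ∀ w, k * w = w * k) (lc : ∀ w, l * w = w * l) (mc : ∀ w, m * w = w * m)
    (A B C D i : R) (hA : A = (16 : F)⁻¹ • ((2 * x - 3) * (2 * x + 1)))
    (hB : B = (16 : F)⁻¹ • ((2 * y - 3) * (2 * y + 1)))
    (hC : C = (16 : F)⁻¹ • ((2 * z - 3) * (2 * z + 1)))
    (hi : i = x + y + z) (hD : D = (2 : F)⁻¹ • (A * B - B * A)) :
    A * B - B * A = 2 * D ∧ B * C - C * B = 2 * D ∧ i * A = A * i ∧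
      (A * D - D * A) + A * C - B * A = (64 : F)⁻¹ • ((2 * i - k - m - 3) * (k - m)) := by
  obtain ⟨a, ha⟩ : ∃ a, a = (2 * x - 3) * (2 * x + 1) := ⟨_, rfl⟩
  obtain ⟨b, hb⟩ : ∃ b, b = (2 * y - 3) * (2 * y + 1) := ⟨_, rfl⟩
  obtain ⟨c, hc⟩ : ∃ c, c = (2 * z - 3) * (2 * z + 1) := ⟨_, rfl⟩
  obtain ⟨d, hd⟩ : ∃ d, d = a * b - b * a := ⟨_, rfl⟩
  obtain ⟨p1, p2, p3⟩ := bi_identities x y z k l m hk hl hm (kc x) (kc y) (kc z) (lc x) (lc y)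
    (lc z) (mc x) (mc y) (mc z) a b c d i ha hb hc hi hd
  rw [← ha] at hA
  rw [← hb] at hB
  rw [← hc] at hC
  have two : ∀ t : R, 2 * t = (2 : F) • t := fun t => by rw [two_mul, two_smul]
  have h16 : (16 : F) = 2 ^ 4 := by norm_num
  have h64 : (64 : F) = 2 ^ 6 := by norm_num
  have q : A * B - B * A = 2 * D := by rw [two, hD, smul_smul, mul_inv_cancel₀ h2, one_smul]
  have q' : B * C - C * B = A * B - B * A := by
    rw [hA, hB, hC]
    simp only [smul_mul_assoc, mul_smul_comm, ← smul_sub]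
    rw [p1, hd]
  refine ⟨q, by rw [q', q], ?_, ?_⟩
  · rw [hA, mul_smul_comm, smul_mul_assoc, p2]
  · have hD' : D = ((2 : F)⁻¹ ^ 9) • d := by
      rw [hD, hA, hB, hd, h16]
      simp only [smul_mul_assoc, mul_smul_comm, ← smul_sub, smul_smul]
      congr 1
      field_simp
    have h3 : (A * D - D * A) + A * C - B * A
        = ((2 : F)⁻¹ ^ 13) • ((a * d - d * a) + 32 * (a * c - b * a)) := by
      have h32 : ∀ t : R, 32 * t = ((2 : F) ^ 5) • t := fun t => by
        rw [Algebra.smul_def, map_pow, map_ofNat]; norm_num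
      rw [h32, hA, hB, hC, hD', h16]
      simp only [smul_mul_assoc, mul_smul_comm, smul_add, smul_sub, smul_smul]
      have e1 : (2 ^ 4 : F)⁻¹ * (2⁻¹) ^ 9 = 2⁻¹ ^ 13 := by field_simp
      have e2 : (2⁻¹ : F) ^ 9 * (2 ^ 4)⁻¹ = 2⁻¹ ^ 13 := by field_simp
      have e3 : (2 ^ 4 : F)⁻¹ * (2 ^ 4)⁻¹ = 2⁻¹ ^ 8 := by field_simp
      have e4 : (2⁻¹ : F) ^ 13 * 2 ^ 5 = 2⁻¹ ^ 8 := by field_simp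
      simp only [e1, e2, e3, e4]
      abel
    have h128 : ∀ t : R, 128 * t = ((2 : F) ^ 7) • t := fun t => by
      rw [Algebra.smul_def, map_pow, map_ofNat]; norm_num
    rw [h3, p3, h128, smul_smul, h64]
    congr 1
    field_simp

namespace BIAlgebra

variable (F : Type*) [Field F]

/-- The image of `A`: `(2X-3)(2X+1)/16`. -/
noncomputable def imA : BIAlgebra F := (16 : F)⁻¹ • ((2 * X F - 3) * (2 * X F + 1))
/-- The image of `B`: `(2Y-3)(2Y+1)/16`. -/
noncomputable def imB : BIAlgebra F := (16 : F)⁻¹ • ((2 * Y F - 3) * (2 * Y F + 1))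
/-- The image of `C`: `(2Z-3)(2Z+1)/16`. -/
noncomputable def imC : BIAlgebra F := (16 : F)⁻¹ • ((2 * Z F - 3) * (2 * Z F + 1))
/-- The image of `D`, forced by `2D = [A,B]`. -/
noncomputable def imD : BIAlgebra F := (2 : F)⁻¹ • (imA F * imB F - imB F * imA F)

/-- An element commuting with the images of `A, B, C` commutes with the image of `D` and hence
with the image of every element of the free algebra. -/
theorem commute_lift (t : BIAlgebra F) (hA : t * imA F = imA F * t) (hB : t * imB F = imB F * t)
    (hC : t * imC F = imC F * t) (f : RacahGen → BIAlgebra F) (fA : f RacahGen.A = imA F)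
    (fB : f RacahGen.B = imB F) (fC : f RacahGen.C = imC F) (fD : f RacahGen.D = imD F)
    (w : FreeAlgebra F RacahGen) : t * FreeAlgebra.lift F f w = FreeAlgebra.lift F f w * t := by
  have hA' : Commute t (imA F) := hA
  have hB' : Commute t (imB F) := hB
  have hC' : Commute t (imC F) := hC
  have hD' : Commute t (imD F) :=
    ((hA'.mul_right hB').sub_right (hB'.mul_right hA')).smul_right _
  change Commute t _
  induction w using FreeAlgebra.induction with
  | grade0 r => simpa using Algebra.commute_algebraMap_right r t
  | grade1 g => cases g <;> simp [fA, fB, fC, fD, hA', hB', hC', hD']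
  | mul a b ha hb => simpa using ha.mul_right hb
  | add a b ha hb => simpa using ha.add_right hb

/-- The images in the Bannai-Ito algebra of the generators of the Racah algebra. -/
noncomputable def zetaGen : RacahGen → BIAlgebra F
  | .A => imA F
  | .B => imB F
  | .C => imC F
  | .D => imD F

theorem zetaGen_relations (hF : ringChar F ≠ 2) ⦃p q : FreeAlgebra F RacahGen⦄
    (h : RacahRel F p q) :
    FreeAlgebra.lift F (zetaGen F) p = FreeAlgebra.lift F (zetaGen F) q := by
  have h2 : (2 : F) ≠ 0 := Ring.two_ne_zero hF
  obtain ⟨a1, a2, a3, a4⟩ := bi_identities_scaled h2 (X F) (Y F) (Z F) (kappa F) (lam F) (mu F)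
    rfl rfl rfl (kappa_central F) (lam_central F) (mu_central F) (imA F) (imB F) (imC F) (imD F)
    (iota F) rfl rfl rfl rfl rfl
  have d2 : imD F = (2 : F)⁻¹ • (imB F * imC F - imC F * imB F) := by rw [a2, ← a1, imD]
  obtain ⟨-, b2, b3, b4⟩ := bi_identities_scaled h2 (Y F) (Z F) (X F) (lam F) (mu F) (kappa F)
    rfl rfl rfl (lam_central F) (mu_central F) (kappa_central F) (imB F) (imC F) (imA F) (imD F)
    (iota F) rfl rfl rfl (by rw [iota]; abel) d2
  have d3 : imD F = (2 : F)⁻¹ • (imC F * imA F - imA F * imC F) := by rw [b2, ← a1, imD]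
  obtain ⟨-, -, c3, c4⟩ := bi_identities_scaled h2 (Z F) (X F) (Y F) (mu F) (kappa F) (lam F)
    rfl rfl rfl (mu_central F) (kappa_central F) (lam_central F) (imC F) (imA F) (imB F) (imD F)
    (iota F) rfl rfl rfl (by rw [iota]; abel) d3
  have key : ∀ (r s t : BIAlgebra F), (∀ w, r * w = w * r) → (∀ w, s * w = w * s) →
      t = (64 : F)⁻¹ • ((2 * iota F - r - s - 3) * (r - s)) → ∀ u, iota F * u = u * iota F →
      t * u = u * t := by
    intro r s t hr hs ht u hu
    have k1 : Commute (iota F) u := hu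
    have k2 : Commute r u := hr u
    have k3 : Commute s u := hs u
    rw [ht]
    exact ((((((Nat.cast_commute 2 u).mul_left k1).sub_left k2).sub_left k3).sub_left
      (Nat.cast_commute 3 u)).mul_left (k2.sub_left k3)).smul_left _
  cases h with
  | comm_AB => simpa [zetaGen, map_ofNat] using a1
  | comm_BC => simpa [zetaGen, map_ofNat] using a2
  | comm_CA => simpa [zetaGen, map_ofNat] using b2
  | central_alpha w =>
    simpa [zetaGen] using commute_lift F _ (key _ _ _ (kappa_central F) (mu_central F) a4 _ a3)
      (key _ _ _ (kappa_central F) (mu_central F) a4 _ b3)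
      (key _ _ _ (kappa_central F) (mu_central F) a4 _ c3) (zetaGen F) rfl rfl rfl rfl w
  | central_beta w =>
    simpa [zetaGen] using commute_lift F _ (key _ _ _ (lam_central F) (kappa_central F) b4 _ a3)
      (key _ _ _ (lam_central F) (kappa_central F) b4 _ b3)
      (key _ _ _ (lam_central F) (kappa_central F) b4 _ c3) (zetaGen F) rfl rfl rfl rfl w
  | central_gamma w =>
    simpa [zetaGen] using commute_lift F _ (key _ _ _ (mu_central F) (lam_central F) c4 _ a3)
      (key _ _ _ (mu_central F) (lam_central F) c4 _ b3)
      (key _ _ _ (mu_central F) (lam_central F) c4 _ c3) (zetaGen F) rfl rfl rfl rfl w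

end BIAlgebra

/-- The algebra homomorphism `ζ` from the Racah algebra to the Bannai-Ito algebra with
`A ↦ (2X-3)(2X+1)/16`, `B ↦ (2Y-3)(2Y+1)/16`, `C ↦ (2Z-3)(2Z+1)/16`
(and hence `D ↦ [ζ(A), ζ(B)]/2`). -/
noncomputable def zeta (F : Type*) [Field F] (hF : ringChar F ≠ 2) :
    RacahAlgebra F →ₐ[F] BIAlgebra F :=
  RingQuot.liftAlgHom F ⟨FreeAlgebra.lift F (BIAlgebra.zetaGen F),
    fun _ _ h => BIAlgebra.zetaGen_relations F hF h⟩

theorem zeta_gen (F : Type*) [Field F] (hF : ringChar F ≠ 2) (g : RacahGen) :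
    zeta F hF (RacahAlgebra.gen F g) = BIAlgebra.zetaGen F g := by
  simp [zeta, RacahAlgebra.gen]

/-!
Let `x = X - 1/2`, `y = Y - 1/2`, `p = ι - 1/2` in the Bannai-Ito algebra. In these elements the
defining relations become
`{x,y} = p - 2x - 2y + κ - 1`, `{p,x} = 2x² + κ + μ`, `{p,y} = 2y² + κ + λ`,
and `p²` is central. So every element is a combination of the words `xⁱ yʲ pᵉ`, `e ≤ 1`, over the
center, and identities are checked by rewriting to such combinations and comparing coefficients.

*Existence.* The polynomials in `ι, κ, λ, μ` form a subalgebra, since these elements commute. The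
map `ζ` sends `α, β, γ, δ` into it (`zeta_central`, `zeta_delta`), so it suffices to treat the
representative `casimirBase` of the Casimir class. Now `ζ(A) = (x² - 1)/4`, `ζ(B) = (y² - 1)/4`,
`ζ(D) = d/32` with `d = [x², y²]`, and `p` commutes with `x²` and `y²`, hence with `d`. Up to the
factor `1024`, the image of `casimirBase` is an expression in `x²`, `y²`, `d`, `p`, and
`ShiftedBI.casimir` evaluates it to `f p + g` with `f, g` polynomials in `κ, λ, μ, p²`. The only
expensive term is `d²`; it is found from `y d` and the Racah relation for `[y² - 1, d]`.

*Uniqueness.* One has to show that `ι, κ, λ, μ` are algebraically independent. For parameters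
`θ, a, c, l` in an extension field `K` there is a dual Verma module of sequences over `K` on which
`κ, λ, μ` act as the scalars `(2θ - 1)(a + c) - l`, `l`, `(2c + 1)(a - θ) + l`, and in which the
evaluation at index `0` turns `ι` into the scalar `a + θ + c`. If two polynomials in `ι, κ, λ, μ`
agree, then they agree at all these points of `K⁴`. Over an algebraically closed `K` every point of
`K⁴` arises, by solving a quadratic equation with leading coefficient `-2` for `θ` and another one
for `c`. As `K` is infinite, the two polynomials are equal.
-/

/-! ### Algebraic independence of `ι, κ, λ, μ` -/

theorem map_evalFour {F R S : Type*} [Field F] [Ring R] [Algebra F R] [Ring S] [Algebra F S]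
    (φ : R →ₐ[F] S) (P : MvPolynomial (Fin 4) F) (a b c d : R) :
    φ (evalFour P a b c d) = evalFour P (φ a) (φ b) (φ c) (φ d) := by
  simp [evalFour]

namespace BIAlgebra

section lift

variable {F R : Type*} [Field F] [Ring R] [Algebra F R]

/-- The algebra homomorphism out of the Bannai-Ito algebra given by three elements `x, y, z` for
which `{x,y} - z`, `{y,z} - x`, `{z,x} - y` are central. -/
theorem exists_lift (x y z : R)
    (hk : ∀ w, (x * y + y * x - z) * w = w * (x * y + y * x - z))
    (hl : ∀ w, (y * z + z * y - x) * w = w * (y * z + z * y - x))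
    (hm : ∀ w, (z * x + x * z - y) * w = w * (z * x + x * z - y)) :
    ∃ ψ : BIAlgebra F →ₐ[F] R, ψ (X F) = x ∧ ψ (Y F) = y ∧ ψ (Z F) = z := by
  let g : BIGen → R := fun | .X => x | .Y => y | .Z => z
  refine ⟨RingQuot.liftAlgHom F ⟨FreeAlgebra.lift F g, ?_⟩, ?_, ?_, ?_⟩
  · rintro p q (w | w | w)
    · simpa [g] using hk _
    · simpa [g] using hl _
    · simpa [g] using hm _
  all_goals simp [X, Y, Z, gen, g]

end lift

section verma

variable {K : Type*} [Field K]

/-- The space on which the dual Verma modules live. A sequence indexed by `i : ℕ` is replaced by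
the pair of its parts of index `2t` and of index `2t + 1`, and the index `t` is allowed to be any
element of `K`, so that the index shift is invertible and polynomial identities in `t` suffice. -/
abbrev VermaSpace (K : Type*) : Type _ := (K → K) × (K → K)

/-- The operator `X` of the dual Verma module with parameters `θ, a, c, l`. -/
def vermaX (a : K) : Module.End K (VermaSpace K) where
  toFun f := (fun t => (a + 2 * t) * f.1 t + f.2 t,
    fun t => -(a + 2 * t + 1) * f.2 t + f.1 (t + 1))
  map_add' f g := by ext t <;> simp <;> ring
  map_smul' r f := by ext t <;> simp <;> ring

/-- The structure constant of the lowering part of `Y` at even indices; it vanishes at `t = 0`,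
which makes evaluation at index `0` an eigenvector of the transpose of `Y`. -/
def vermaEven (θ a c t : K) : K := -(2 * t * (a + c)) - t * (2 * θ - 1 + 4 * t)

/-- The structure constant of the lowering part of `Y` at odd indices. -/
def vermaOdd (θ a c l t : K) : K :=
  2 * θ * c - c - l + θ + 1 + 3 * t + (c - θ - a - (2 * t + 1)) * (2 * t + 1)

/-- The operator `Y` of the dual Verma module with parameters `θ, a, c, l`. -/
def vermaY (θ a c l : K) : Module.End K (VermaSpace K) where
  toFun f := (fun t => (θ + 2 * t) * f.1 t + vermaEven θ a c t * f.2 (t - 1),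
    fun t => -(θ + 2 * t + 1) * f.2 t + vermaOdd θ a c l t * f.1 t)
  map_add' f g := by ext t <;> simp <;> ring
  map_smul' r f := by ext t <;> simp <;> ring

/-- The operator `Z` of the dual Verma module with parameters `θ, a, c, l`. -/
def vermaZ (θ a c l : K) : Module.End K (VermaSpace K) where
  toFun f := (fun t => c * f.1 t - f.2 t + vermaEven θ a c t * f.2 (t - 1),
    fun t => -(1 + c) * f.2 t + f.1 (t + 1) - vermaOdd θ a c l t * f.1 t)
  map_add' f g := by ext t <;> simp <;> ring
  map_smul' r f := by ext t <;> simp <;> ring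

variable (θ a c l : K)

theorem verma_kappa : vermaX a * vermaY θ a c l + vermaY θ a c l * vermaX a - vermaZ θ a c l
    = algebraMap K _ ((2 * θ - 1) * (a + c) - l) := by
  ext f t <;> simp [vermaX, vermaY, vermaZ, vermaEven, vermaOdd] <;> ring

theorem verma_lam : vermaY θ a c l * vermaZ θ a c l + vermaZ θ a c l * vermaY θ a c l - vermaX a
    = algebraMap K _ l := by
  ext f t <;> simp [vermaX, vermaY, vermaZ, vermaEven, vermaOdd] <;> ring

theorem verma_mu : vermaZ θ a c l * vermaX a + vermaX a * vermaZ θ a c l - vermaY θ a c l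
    = algebraMap K _ ((2 * c + 1) * (a - θ) + l) := by
  ext f t <;> simp [vermaX, vermaY, vermaZ, vermaEven, vermaOdd] <;> ring

/-- Evaluation at index `0` is an eigenvector of the transpose of `ι`. -/
theorem verma_iota_pow (n : ℕ) (f : VermaSpace K) :
    (((vermaX a + vermaY θ a c l + vermaZ θ a c l) ^ n) f).1 0 = (a + θ + c) ^ n * f.1 0 := by
  induction n with
  | zero => simp
  | succ n ih =>
    rw [pow_succ', Module.End.mul_apply, pow_succ', mul_assoc, ← ih]
    simp [vermaX, vermaY, vermaZ, vermaEven]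
    ring

theorem verma_evalFour {F : Type*} [Field F] [Algebra F K] (r s q : K)
    (P : MvPolynomial (Fin 4) F) (f : VermaSpace K) :
    (evalFour P (vermaX a + vermaY θ a c l + vermaZ θ a c l) (algebraMap K _ r) (algebraMap K _ s)
      (algebraMap K _ q) f).1 0 = MvPolynomial.aeval ![a + θ + c, r, s, q] P * f.1 0 := by
  rw [evalFour, MvPolynomial.aeval_def, MvPolynomial.eval₂_eq', Finset.sum_mul]
  simp only [← map_pow, LinearMap.sum_apply, Prod.fst_sum, Finset.sum_apply,
    LinearMap.smul_apply, Prod.smul_fst, Pi.smul_apply, Module.End.mul_apply, verma_iota_pow,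
    Module.algebraMap_end_apply]
  refine Finset.sum_congr rfl fun m _ => ?_
  simp only [Algebra.smul_def, Fin.prod_univ_four, Algebra.algebraMap_self, RingHom.id_apply,
    Matrix.cons_val]
  ring

end verma

variable {F : Type*} [Field F]

/-- An equality of two polynomial expressions in `ι, κ, λ, μ` yields the equality of the values of
the polynomials at the point of `K⁴` attached to a dual Verma module. -/
theorem aeval_eq_of_evalFour_eq {K : Type*} [Field K] [Algebra F K] {P Q : MvPolynomial (Fin 4) F}
    (h : evalFour P (iota F) (kappa F) (lam F) (mu F)
      = evalFour Q (iota F) (kappa F) (lam F) (mu F)) (θ a c l : K) :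
    MvPolynomial.aeval ![a + θ + c, (2 * θ - 1) * (a + c) - l, l, (2 * c + 1) * (a - θ) + l] P
      = MvPolynomial.aeval
        ![a + θ + c, (2 * θ - 1) * (a + c) - l, l, (2 * c + 1) * (a - θ) + l] Q := by
  obtain ⟨ψ, hX, hY, hZ⟩ := exists_lift (F := F) (vermaX a) (vermaY θ a c l) (vermaZ θ a c l)
    (fun w => by rw [verma_kappa]; exact Algebra.commutes _ w)
    (fun w => by rw [verma_lam]; exact Algebra.commutes _ w)
    (fun w => by rw [verma_mu]; exact Algebra.commutes _ w)
  -- The value of a polynomial in `ι, κ, λ, μ` on `(1, 0)`, read off at index `0`.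
  have key : ∀ P : MvPolynomial (Fin 4) F,
      (ψ (evalFour P (iota F) (kappa F) (lam F) (mu F)) (fun _ => 1, fun _ => 0)).1 0
        = MvPolynomial.aeval
          ![a + θ + c, (2 * θ - 1) * (a + c) - l, l, (2 * c + 1) * (a - θ) + l] P := by
    intro P
    rw [map_evalFour, iota, kappa, lam, mu]
    simp only [map_add ψ, map_sub ψ, map_mul ψ, hX, hY, hZ, verma_kappa, verma_lam, verma_mu]
    rw [verma_evalFour, mul_one]
  rw [← key, ← key, h]

theorem exists_root_quadratic {K : Type*} [Field K] [IsAlgClosed K] (h2 : (-2 : K) ≠ 0) (b c : K) :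
    ∃ t : K, -2 * t ^ 2 + b * t + c = 0 := by
  obtain ⟨t, ht⟩ := IsAlgClosed.exists_root
    (Polynomial.C (-2 : K) * Polynomial.X ^ 2 + Polynomial.C b * Polynomial.X + Polynomial.C c)
    (by rw [Polynomial.degree_quadratic h2]; decide)
  exact ⟨t, by simpa [Polynomial.IsRoot.def] using ht⟩

/-- `ι, κ, λ, μ` are algebraically independent. -/
theorem evalFour_injective (h2 : (2 : F) ≠ 0) {P Q : MvPolynomial (Fin 4) F}
    (h : evalFour P (iota F) (kappa F) (lam F) (mu F)
      = evalFour Q (iota F) (kappa F) (lam F) (mu F)) : P = Q := by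
  let K := AlgebraicClosure F
  have h2K : (-2 : K) ≠ 0 := by
    rw [neg_ne_zero, ← map_ofNat (algebraMap F K) 2]
    exact (map_ne_zero _).2 h2
  refine MvPolynomial.map_injective _ (algebraMap F K).injective (MvPolynomial.funext fun w => ?_)
  -- Substituting `a = w₀ - θ - c` to get `a + θ + c = w₀`, the conditions on the second and fourth
  -- coordinates become quadratic equations, for `θ` alone and then for `c`.
  obtain ⟨θ, hθ⟩ := exists_root_quadratic h2K (2 * w 0 + 1) (-w 0 - w 1 - w 2)
  obtain ⟨c, hc⟩ := exists_root_quadratic h2K (2 * w 0 - 4 * θ - 1) (w 0 - 2 * θ - w 3 + w 2)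
  have hw : w = ![(w 0 - θ - c) + θ + c, (2 * θ - 1) * ((w 0 - θ - c) + c) - w 2, w 2,
      (2 * c + 1) * ((w 0 - θ - c) - θ) + w 2] := by
    ext i
    fin_cases i
    · simp; ring
    · simp; linear_combination -hθ
    · simp
    · simp; linear_combination -hc
  have := aeval_eq_of_evalFour_eq h θ (w 0 - θ - c) c (w 2)
  rw [← hw] at this
  rwa [MvPolynomial.eval_map, MvPolynomial.eval_map]

end BIAlgebra

/-! ### The Casimir element in shifted generators -/

/-- The relations of the Bannai-Ito algebra in the elements `x = X - 1/2`, `y = Y - 1/2`,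
`p = ι - 1/2`, over a commutative ring `S` that contains `κ, λ, μ` and the central element
`s = p²`. They rewrite every word into a combination of the `xⁱ yʲ pᵉ` with `e ≤ 1`. -/
structure ShiftedBI {S R : Type*} [CommRing S] [Ring R] [Algebra S R] (k l m s : S) (x y p : R) :
    Prop where
  y_mul_x : y * x = -(x * y) - (2 : S) • x - (2 : S) • y + p + (k - 1) • (1 : R)
  p_mul_x : p * x = -(x * p) + (2 : S) • (x * x) + (k + m) • (1 : R)
  p_mul_y : p * y = -(y * p) + (2 : S) • (y * y) + (k + l) • (1 : R)
  p_mul_p : p * p = s • (1 : R)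

/-- The coefficient of `ι - 1/2` in `1024` times the image of the Casimir element, as a polynomial
in `κ, λ, μ` and `s = (ι - 1/2)²`. -/
def casimirIotaCoeff {S : Type*} [CommRing S] (k l m s : S) : S :=
  4 * k ^ 2 + 12 * k * l + 12 * k * m - 8 * k * s - 32 * k + 4 * l * m - 16 * l - 16 * m
    + 24 * s - 96

/-- The part of `1024` times the image of the Casimir element that does not involve `ι - 1/2`, as a
polynomial in `κ, λ, μ` and `s = (ι - 1/2)²`. -/
def casimirConstCoeff {S : Type*} [CommRing S] (k l m s : S) : S :=
  -4 * k ^ 3 - 4 * k ^ 2 * l - 4 * k ^ 2 * m + 4 * k ^ 2 * s - 20 * k ^ 2 - 4 * k * l * m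
    - 44 * k * l - 44 * k * m + 40 * k * s - 96 * k - 16 * l ^ 2 - 36 * l * m + 24 * l * s
    - 104 * l - 16 * m ^ 2 + 24 * m * s - 104 * m - 12 * s ^ 2 + 84 * s - 144

namespace ShiftedBI

variable {S R : Type*} [CommRing S] [Ring R] [Algebra S R] {k l m s : S} {x y p : R}
  (h : ShiftedBI k l m s x y p)
include h

theorem y_mul_x_mul (w : R) : y * (x * w) =
    -(x * (y * w)) - (2 : S) • (x * w) - (2 : S) • (y * w) + p * w + (k - 1) • w := by
  rw [← mul_assoc, h.y_mul_x]
  simp only [sub_mul, add_mul, neg_mul, smul_mul_assoc, mul_assoc, one_mul]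

theorem p_mul_x_mul (w : R) : p * (x * w) =
    -(x * (p * w)) + (2 : S) • (x * (x * w)) + (k + m) • w := by
  rw [← mul_assoc, h.p_mul_x]
  simp only [add_mul, neg_mul, smul_mul_assoc, mul_assoc, one_mul]

theorem p_mul_y_mul (w : R) : p * (y * w) =
    -(y * (p * w)) + (2 : S) • (y * (y * w)) + (k + l) • w := by
  rw [← mul_assoc, h.p_mul_y]
  simp only [add_mul, neg_mul, smul_mul_assoc, mul_assoc, one_mul]

theorem p_mul_sq_x : p * x ^ 2 = x ^ 2 * p := by
  simp only [pow_two, mul_assoc, h.p_mul_x, h.p_mul_x_mul, mul_add, mul_neg, mul_smul_comm,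
    mul_one]
  match_scalars <;> ring

theorem p_mul_sq_y : p * y ^ 2 = y ^ 2 * p := by
  simp only [pow_two, mul_assoc, h.p_mul_y, h.p_mul_y_mul, mul_add, mul_neg, mul_smul_comm,
    mul_one]
  match_scalars <;> ring

theorem y_mul_sq_x : y * x ^ 2 = (1 : S) • (x ^ 2 * y)
      + (-2 : S) • (x * p)
      + (4 : S) • (x * y)
      + (2 : S) • (x ^ 2)
      + (-2 : S) • p
      + (4 : S) • y
      + (4 : S) • x
      + (-k + m + 2 : S) • 1 := by
  simp only [pow_two, mul_assoc, h.p_mul_x, h.y_mul_x, h.y_mul_x_mul, mul_add, mul_sub, mul_neg,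
    mul_smul_comm, mul_one]
  match_scalars <;> ring

/-- The normal form of `d = [x², y²]`, which is `32` times the image of `D`. -/
theorem comm_sq_sq : x ^ 2 * y ^ 2 - y ^ 2 * x ^ 2 = (-4 : S) • (x * y * p)
      + (4 : S) • (x * y ^ 2)
      + (-4 : S) • (x ^ 2 * y)
      + (-4 : S) • (y ^ 2)
      + (-4 : S) • (x ^ 2)
      + (2 * k - 2 : S) • p
      + (-2 * k - 2 * m : S) • y
      + (2 * k + 2 * l : S) • x
      + (-4 * k - 2 * l - 2 * m + 2 * s : S) • 1 := by
  rw [pow_two y, mul_assoc y y, h.y_mul_sq_x]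
  simp only [pow_two, mul_assoc, h.p_mul_x, h.p_mul_y, h.p_mul_p, h.y_mul_x, h.y_mul_x_mul,
    h.p_mul_x_mul, mul_add, mul_sub, mul_neg, mul_smul_comm, mul_one]
  match_scalars <;> ring

variable {d : R} (hd : x ^ 2 * y ^ 2 - y ^ 2 * x ^ 2 = d)
include hd

theorem p_mul_comm : p * d = d * p := by
  simp only [← hd, mul_sub, sub_mul, ← mul_assoc, h.p_mul_sq_x, h.p_mul_sq_y]
  simp only [mul_assoc, h.p_mul_sq_x, h.p_mul_sq_y]

/-- The normal form of `y d`; multiplying `d` by `y` on the left is the only costly product in the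
computation of `d²`. -/
theorem y_mul_comm : y * d = (4 : S) • (x * y ^ 2 * p)
      + (-4 : S) • (x * y ^ 3)
      + (-4 : S) • (x ^ 2 * y ^ 2)
      + (4 : S) • (y ^ 2 * p)
      + (-12 : S) • (y ^ 3)
      + (-8 : S) • (x * y ^ 2)
      + (-12 : S) • (x ^ 2 * y)
      + (-2 * k - 6 : S) • (y * p)
      + (2 * k - 2 * m - 4 : S) • (y ^ 2)
      + (8 : S) • (x * p)
      + (-2 * k - 2 * l - 32 : S) • (x * y)
      + (-8 : S) • (x ^ 2)
      + (-2 * k - 2 * l + 8 : S) • p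
      + (-4 * k - 6 * l - 6 * m + 6 * s - 24 : S) • y
      + (4 * k + 4 * l - 16 : S) • x
      + (2 * k ^ 2 + 2 * k * l + 10 * k + 6 * l - 4 * m - 8 : S) • 1 := by
  rw [← hd, h.comm_sq_sq]
  simp only [pow_succ, pow_zero, mul_assoc, h.p_mul_x, h.p_mul_y, h.p_mul_p, h.y_mul_x,
    h.y_mul_x_mul, h.p_mul_y_mul, h.p_mul_x_mul, mul_add, mul_sub, mul_neg,
    mul_smul_comm, mul_one, one_mul]
  match_scalars <;> ring

/-- The relation `[A,D] + AC - BA = α` of the Racah algebra, with `u = 4A`, `v = 4B`, `d = 32D`,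
`e = 4δ` and `64α` in place of `α`. -/
theorem sq_x_comm (u v e α : R) (hu : u = x ^ 2 - 1) (hv : v = y ^ 2 - 1)
    (he : e = (s - k - l - m - 3) • (1 : R) - p)
    (hα : α = (k - m) • (2 • p - (k + m + 2) • 1)) :
    u * d - d * u = 2 • α - 8 • (u * e - u * u - u * v - v * u) := by
  have hvu : v * u = u * v - d := by rw [← hd, hu, hv]; noncomm_ring
  have h1 : u * d - d * u = x ^ 2 * d - d * x ^ 2 := by rw [hu]; noncomm_ring
  rw [hα, hvu, h1, ← hd, he, hu, hv, h.comm_sq_sq]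
  simp only [add_mul, smul_mul_assoc, mul_assoc, h.p_mul_sq_x, h.y_mul_sq_x, one_mul]
  rw [pow_two y, mul_assoc y y, h.y_mul_sq_x]
  simp only [pow_succ, pow_zero, mul_assoc, h.p_mul_x, h.p_mul_y, h.p_mul_p, h.y_mul_x,
    h.y_mul_x_mul, h.p_mul_x_mul, mul_add, mul_sub, sub_mul, mul_neg,
    mul_smul_comm, mul_one, one_mul, smul_add, smul_sub]
  match_scalars <;> ring

/-- The relation `[B,D] + BA - CB = β` of the Racah algebra, with `u = 4A`, `v = 4B`, `d = 32D`,
`e = 4δ` and `64β` in place of `β`. -/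
theorem sq_y_comm (u v e β : R) (hu : u = x ^ 2 - 1) (hv : v = y ^ 2 - 1)
    (he : e = (s - k - l - m - 3) • (1 : R) - p)
    (hβ : β = (l - k) • (2 • p - (k + l + 2) • 1)) :
    v * d - d * v = 2 • β - 8 • (v * u - e * v + u * v + v * v) := by
  have hvu : v * u = u * v - d := by rw [← hd, hu, hv]; noncomm_ring
  have h1 : v * d - d * v = y * (y * d) - d * y ^ 2 := by rw [hv]; noncomm_ring
  rw [hβ, hvu, h1, h.y_mul_comm hd, ← hd, he, hu, hv, h.comm_sq_sq]
  simp only [pow_succ, pow_zero, mul_assoc, h.p_mul_x, h.p_mul_y, h.p_mul_p, h.y_mul_x,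
    h.y_mul_x_mul, h.p_mul_y_mul, h.p_mul_x_mul, mul_add, mul_sub, sub_mul, add_mul, mul_neg,
    smul_mul_assoc, mul_smul_comm, mul_one, one_mul, smul_add, smul_sub]
  match_scalars <;> ring

/-- The value of `1024` times the Casimir element, where `u = 4A`, `v = 4B`, `d = 32D`, `e = 4δ`,
and `α, β` are `64` times the central elements of the same name. -/
theorem casimir (u v e α β : R) (hu : u = x ^ 2 - 1) (hv : v = y ^ 2 - 1)
    (he : e = (s - k - l - m - 3) • (1 : R) - p)
    (hα : α = (k - m) • (2 • p - (k + m + 2) • 1)) (hβ : β = (l - k) • (2 • p - (k + l + 2) • 1)) :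
    d * d + 64 • (u * u + v * v) + 8 • ((e + 8 • 1) * (u * v + v * u))
      - 8 • (u * u * v + v * (u * u)) - 8 • (u * (v * v) + v * v * u)
      + 4 • (u * β) - 64 • (u * e) - 64 • (v * e) - 4 • (v * α)
    = casimirIotaCoeff k l m s • p + casimirConstCoeff k l m s • 1 := by
  have hvu : v * u = u * v - d := by rw [← hd, hu, hv]; noncomm_ring
  have hvd : v * d = d * v + (v * d - d * v) := by abel
  have huu : v * (u * u) = u * u * v - 2 • (u * d) + (u * d - d * u) := by
    have : v * (u * u) = (v * u) * u := by rw [mul_assoc]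
    rw [this, hvu, sub_mul, mul_assoc, hvu, two_smul]
    noncomm_ring
  have hvv : v * v * u = u * v * v - 2 • (d * v) - (v * d - d * v) := by
    rw [mul_assoc, hvu, mul_sub, ← mul_assoc, hvu, two_smul]
    noncomm_ring
  have hpu : p * u = u * p := by rw [hu]; simp [mul_sub, sub_mul, h.p_mul_sq_x]
  have hdp := h.p_mul_comm hd
  have hy : y ^ 2 = v + 1 := by rw [hv]; abel
  -- Only the products `y d` and `[v, d]` are needed, because `p` commutes with `d`.
  have hdd : d * d = (-4 : S) • (x * (y * d) * p) + (4 : S) • (x * (v * d + d))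
      + (-4 : S) • (x ^ 2 * (y * d)) + (-4 : S) • (v * d + d) + (-4 : S) • (x ^ 2 * d)
      + (2 * k - 2 : S) • (d * p) + (-2 * k - 2 * m : S) • (y * d) + (2 * k + 2 * l : S) • (x * d)
      + (-4 * k - 2 * l - 2 * m + 2 * s : S) • d := by
    have : d * d = (x ^ 2 * y ^ 2 - y ^ 2 * x ^ 2) * d := by rw [hd]
    rw [this, h.comm_sq_sq]
    simp only [add_mul, smul_mul_assoc, mul_assoc, hdp, one_mul, hy]
  rw [hdd, huu, hvv, hvu, hvd, h.sq_x_comm hd u v e α hu hv he hα,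
    h.sq_y_comm hd u v e β hu hv he hβ, hvu, h.y_mul_comm hd, hα, hβ, he, ← hd, h.comm_sq_sq, hv,
    casimirIotaCoeff, casimirConstCoeff]
  simp only [mul_add, mul_sub, sub_mul, add_mul, mul_assoc, smul_mul_assoc, mul_smul_comm, mul_one,
    one_mul, hpu]
  rw [hu]
  simp only [pow_succ, pow_zero, mul_assoc, h.p_mul_x, h.p_mul_y, h.p_mul_p, h.p_mul_y_mul,
    h.p_mul_x_mul, mul_add, mul_sub, sub_mul, mul_neg, mul_smul_comm, mul_one, one_mul, smul_add,
    smul_sub]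
  match_scalars <;> ring

end ShiftedBI

/-! ### The image of the Casimir class -/

/-- Rescaling of the Casimir expression to the normalization of the Racah algebra. -/
theorem casimir_rescale {F R : Type*} [Field F] (h2 : (2 : F) ≠ 0) [Ring R] [Algebra F R]
    {A B D α β δ u v d e a b : R} (hA : A = (2⁻¹ ^ 2 : F) • u) (hB : B = (2⁻¹ ^ 2 : F) • v)
    (hD : D = (2⁻¹ ^ 5 : F) • d) (hδ : δ = (2⁻¹ ^ 2 : F) • e) (hα : α = (2⁻¹ ^ 6 : F) • a)
    (hβ : β = (2⁻¹ ^ 6 : F) • b) :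
    D ^ 2 + A ^ 2 + B ^ 2 + (2 : F)⁻¹ • ((δ + 2) * (A * B + B * A) - (A ^ 2 * B + B * A ^ 2)
        - (A * B ^ 2 + B ^ 2 * A)) + A * (β - δ) - B * (δ + α)
      = (2⁻¹ ^ 10 : F) • (d * d + 64 • (u * u + v * v) + 8 • ((e + 8 • 1) * (u * v + v * u))
      - 8 • (u * u * v + v * (u * u)) - 8 • (u * (v * v) + v * v * u)
      + 4 • (u * b) - 64 • (u * e) - 64 • (v * e) - 4 • (v * a)) := by
  subst hA hB hD hδ hα hβ
  have two : (2 : R) = (2 : F) • 1 := by rw [Algebra.smul_def, map_ofNat, mul_one]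
  simp only [two, pow_two, mul_add, add_mul, mul_sub, smul_mul_assoc, mul_smul_comm, mul_assoc,
    one_mul]
  match_scalars <;> field_simp <;> ring

theorem casimirCoeff_mem {S R : Type*} [CommRing S] [Ring R] [Algebra S R] (T : Subring R)
    {k l m s : S} {p : R} (hk : algebraMap S R k ∈ T) (hl : algebraMap S R l ∈ T)
    (hm : algebraMap S R m ∈ T) (hs : algebraMap S R s ∈ T) (hp : p ∈ T) :
    casimirIotaCoeff k l m s • p + casimirConstCoeff k l m s • 1 ∈ T := by
  rw [Algebra.smul_def, Algebra.smul_def]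
  refine add_mem (mul_mem ?_ hp) (mul_mem ?_ (one_mem T))
  all_goals
    rw [← Subring.mem_comap] at *
    simp only [casimirIotaCoeff, casimirConstCoeff]
    repeat' first
      | assumption | exact ofNat_mem _ _ | apply pow_mem | apply add_mem | apply sub_mem
      | apply mul_mem | apply neg_mem

namespace BIAlgebra

variable {F : Type*} [Field F]

theorem commute_of_commute_gens {t : BIAlgebra F} (hX : Commute t (X F)) (hY : Commute t (Y F))
    (hZ : Commute t (Z F)) (w : BIAlgebra F) : Commute t w := by
  obtain ⟨w, rfl⟩ := RingQuot.mkAlgHom_surjective F (BIRel F) w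
  induction w using FreeAlgebra.induction with
  | grade0 r => simpa using Algebra.commute_algebraMap_right r t
  | grade1 g => cases g <;> assumption
  | mul a b ha hb => simpa using ha.mul_right hb
  | add a b ha hb => simpa using ha.add_right hb

/-- If `{p,x} - 2x²` commutes with `p` and `x`, then `p` commutes with `x²` and so `p²` with `x`. -/
theorem commute_sq_of_anticomm {R : Type*} [Ring R] {p x c : R}
    (h : p * x + x * p = 2 * (x * x) + c) (hx : Commute c x) (hp : Commute c p) :
    Commute (p * p) x := by
  change p * p * x = x * (p * p)
  linear_combination (norm := noncomm_ring)
    p * h - h * p + 2 * (h * x - x * h) + 2 * hx.eq - hp.eq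

/-- The Bannai-Ito algebra as an algebra over its center, with the scalar multiplication that
Mathlib has for subalgebras. -/
noncomputable instance centerAlgebra :
    Algebra (Subalgebra.center F (BIAlgebra F)) (BIAlgebra F) :=
  Algebra.ofModule (fun c v w => mul_assoc (c : BIAlgebra F) v w)
    (fun c v w => by
      rw [Subalgebra.smul_def, Subalgebra.smul_def, smul_eq_mul, smul_eq_mul, ← mul_assoc,
        Subalgebra.mem_center_iff.1 c.2 v, mul_assoc])

theorem center_smul (c : Subalgebra.center F (BIAlgebra F)) (w : BIAlgebra F) : c • w = c * w :=
  rfl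

theorem center_two : ((2 : Subalgebra.center F (BIAlgebra F)) : BIAlgebra F) = 2 := rfl

/-- `X - 1/2`, `Y - 1/2` and `ι - 1/2` satisfy the shifted relations over the center. -/
theorem exists_shiftedBI (h2 : (2 : F) ≠ 0) :
    ∃ k l m s : Subalgebra.center F (BIAlgebra F), (k : BIAlgebra F) = kappa F ∧
      (l : BIAlgebra F) = lam F ∧ (m : BIAlgebra F) = mu F ∧
      (s : BIAlgebra F) = (iota F - (2 : F)⁻¹ • 1) * (iota F - (2 : F)⁻¹ • 1) ∧
      ShiftedBI k l m s (X F - (2 : F)⁻¹ • 1) (Y F - (2 : F)⁻¹ • 1) (iota F - (2 : F)⁻¹ • 1) := by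
  have two : (2 : BIAlgebra F) = (2 : F) • 1 := by rw [Algebra.smul_def, map_ofNat, mul_one]
  set p := iota F - (2 : F)⁻¹ • 1 with hp
  set x := X F - (2 : F)⁻¹ • 1 with hx
  set y := Y F - (2 : F)⁻¹ • 1 with hy
  have hpx : p * x + x * p = 2 * (x * x) + (kappa F + mu F) := by
    simp only [hp, hx, iota, kappa, mu, two, mul_add, add_mul, mul_sub, sub_mul, smul_mul_assoc,
      mul_smul_comm, one_mul, mul_one]
    match_scalars <;> field_simp <;> ring
  have hpy : p * y + y * p = 2 * (y * y) + (kappa F + lam F) := by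
    simp only [hp, hy, iota, kappa, lam, two, mul_add, add_mul, mul_sub, sub_mul, smul_mul_assoc,
      mul_smul_comm, one_mul, mul_one]
    match_scalars <;> field_simp <;> ring
  have hxy : y * x = -(x * y) - 2 * x - 2 * y + p + (kappa F - 1) := by
    simp only [hp, hx, hy, iota, kappa, two, mul_sub, sub_mul, smul_mul_assoc, mul_smul_comm,
      one_mul, mul_one]
    match_scalars <;> field_simp <;> ring
  have hk : ∀ w, Commute (kappa F) w := kappa_central F
  have hl : ∀ w, Commute (lam F) w := lam_central F
  have hm : ∀ w, Commute (mu F) w := mu_central F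
  have hh : ∀ w : BIAlgebra F, Commute ((2 : F)⁻¹ • 1) w := fun w =>
    (Commute.one_left w).smul_left _
  have hX : Commute (p * p) (X F) := by
    have := (commute_sq_of_anticomm hpx ((hk _).add_left (hm _)) ((hk _).add_left (hm _))).add_right
      (hh (p * p)).symm
    simpa [hx] using this
  have hY : Commute (p * p) (Y F) := by
    have := (commute_sq_of_anticomm hpy ((hk _).add_left (hl _)) ((hk _).add_left (hl _))).add_right
      (hh (p * p)).symm
    simpa [hy] using this
  have hZ : Commute (p * p) (Z F) := by
    have hpp : Commute (p * p) p := (Commute.refl p).mul_left (Commute.refl p)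
    have := ((hpp.add_right (hh (p * p)).symm).sub_right hX).sub_right hY
    have hz : p + (2 : F)⁻¹ • 1 - X F - Y F = Z F := by rw [hp, iota]; abel
    rwa [hz] at this
  refine ⟨⟨kappa F, Subalgebra.mem_center_iff.2 fun w => (hk w).symm⟩,
    ⟨lam F, Subalgebra.mem_center_iff.2 fun w => (hl w).symm⟩,
    ⟨mu F, Subalgebra.mem_center_iff.2 fun w => (hm w).symm⟩,
    ⟨p * p, Subalgebra.mem_center_iff.2 fun w => (commute_of_commute_gens hX hY hZ w).symm⟩,
    rfl, rfl, rfl, rfl, ?_, ?_, ?_, ?_⟩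
  · simp only [center_smul, center_two, mul_one]
    exact hxy
  · simp only [center_smul, Subalgebra.coe_add, center_two, mul_one]
    rw [add_assoc, ← hpx]; abel
  · simp only [center_smul, Subalgebra.coe_add, center_two, mul_one]
    rw [add_assoc, ← hpy]; abel
  · simp only [center_smul, mul_one]

variable (F) in
/-- The subalgebra generated by `ι, κ, λ, μ`. -/
noncomputable def iotaSubalgebra : Subalgebra F (BIAlgebra F) :=
  Algebra.adjoin F {iota F, kappa F, lam F, mu F}

theorem iota_mem : iota F ∈ iotaSubalgebra F := Algebra.subset_adjoin (by simp)
theorem kappa_mem : kappa F ∈ iotaSubalgebra F := Algebra.subset_adjoin (by simp)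
theorem lam_mem : lam F ∈ iotaSubalgebra F := Algebra.subset_adjoin (by simp)
theorem mu_mem : mu F ∈ iotaSubalgebra F := Algebra.subset_adjoin (by simp)

open scoped IsMulCommutative in
/-- Since `ι, κ, λ, μ` commute, the subalgebra they generate consists of the values of
polynomials. -/
theorem exists_evalFour_of_mem {w : BIAlgebra F} (hw : w ∈ iotaSubalgebra F) :
    ∃ P : MvPolynomial (Fin 4) F, w = evalFour P (iota F) (kappa F) (lam F) (mu F) := by
  have hk := kappa_central F
  have hl := lam_central F
  have hm := mu_central F
  have hc : IsMulCommutative (iotaSubalgebra F) := Algebra.isMulCommutative_adjoin F (by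
    rintro a (rfl | rfl | rfl | rfl) b (rfl | rfl | rfl | rfl) <;>
      simp only [← hk (iota F), ← hl (iota F), ← hm (iota F), hk (lam F), hk (mu F), hl (mu F)])
  let g : Fin 4 → iotaSubalgebra F :=
    ![⟨_, iota_mem⟩, ⟨_, kappa_mem⟩, ⟨_, lam_mem⟩, ⟨_, mu_mem⟩]
  have key : ∀ P : MvPolynomial (Fin 4) F,
      ((MvPolynomial.aeval g P : iotaSubalgebra F) : BIAlgebra F)
      = evalFour P (iota F) (kappa F) (lam F) (mu F) := by
    intro P
    rw [MvPolynomial.aeval_def, MvPolynomial.eval₂_eq', evalFour, AddSubmonoidClass.coe_finsetSum]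
    refine Finset.sum_congr rfl fun m _ => ?_
    rw [← Algebra.smul_def, Fin.prod_univ_four]
    rfl
  have hle : iotaSubalgebra F ≤ (MvPolynomial.aeval g).range.map (iotaSubalgebra F).val := by
    refine Algebra.adjoin_le ?_
    rintro a (rfl | rfl | rfl | rfl)
    · exact ⟨_, ⟨MvPolynomial.X 0, MvPolynomial.aeval_X g 0⟩, rfl⟩
    · exact ⟨_, ⟨MvPolynomial.X 1, MvPolynomial.aeval_X g 1⟩, rfl⟩
    · exact ⟨_, ⟨MvPolynomial.X 2, MvPolynomial.aeval_X g 2⟩, rfl⟩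
    · exact ⟨_, ⟨MvPolynomial.X 3, MvPolynomial.aeval_X g 3⟩, rfl⟩
  obtain ⟨_, ⟨P, rfl⟩, rfl⟩ := hle hw
  exact ⟨P, key P⟩

/-- The images of `A, B, C` in shifted form: `(2t - 3)(2t + 1)/16 = ((t - 1/2)² - 1)/4`. -/
theorem two_mul_sub_three_mul (h2 : (2 : F) ≠ 0) (t : BIAlgebra F) :
    (16 : F)⁻¹ • ((2 * t - 3) * (2 * t + 1)) = (2⁻¹ ^ 2 : F) • ((t - (2 : F)⁻¹ • 1) ^ 2 - 1) := by
  have two : (2 : BIAlgebra F) = (2 : F) • 1 := by rw [Algebra.smul_def, map_ofNat, mul_one]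
  have three : (3 : BIAlgebra F) = (3 : F) • 1 := by rw [Algebra.smul_def, map_ofNat, mul_one]
  have h16 : (16 : F) = 2 ^ 4 := by norm_num
  simp only [two, three, h16, pow_two, mul_add, mul_sub, sub_mul, smul_mul_assoc,
    mul_smul_comm, one_mul, mul_one]
  match_scalars <;> field_simp <;> ring

/-- The images of `α, β, γ`, which arise from one identity by cyclic permutation of `X, Y, Z`. -/
theorem zeta_central (hF : ringChar F ≠ 2) :
    zeta F hF (RacahAlgebra.alpha F)
        = (64 : F)⁻¹ • ((2 * iota F - kappa F - mu F - 3) * (kappa F - mu F)) ∧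
      zeta F hF (RacahAlgebra.beta F)
        = (64 : F)⁻¹ • ((2 * iota F - lam F - kappa F - 3) * (lam F - kappa F)) ∧
      zeta F hF (RacahAlgebra.gamma F)
        = (64 : F)⁻¹ • ((2 * iota F - mu F - lam F - 3) * (mu F - lam F)) := by
  have h2 : (2 : F) ≠ 0 := Ring.two_ne_zero hF
  have zA : zeta F hF (RacahAlgebra.A F) = imA F := zeta_gen F hF _
  have zB : zeta F hF (RacahAlgebra.B F) = imB F := zeta_gen F hF _
  have zC : zeta F hF (RacahAlgebra.C F) = imC F := zeta_gen F hF _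
  have zD : zeta F hF (RacahAlgebra.D F) = imD F := zeta_gen F hF _
  obtain ⟨a1, a2, -, a4⟩ := bi_identities_scaled h2 (X F) (Y F) (Z F) (kappa F) (lam F) (mu F)
    rfl rfl rfl (kappa_central F) (lam_central F) (mu_central F) (imA F) (imB F) (imC F) (imD F)
    (iota F) rfl rfl rfl rfl rfl
  have d2 : imD F = (2 : F)⁻¹ • (imB F * imC F - imC F * imB F) := by rw [a2, ← a1, imD]
  obtain ⟨-, b2, -, b4⟩ := bi_identities_scaled h2 (Y F) (Z F) (X F) (lam F) (mu F) (kappa F)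
    rfl rfl rfl (lam_central F) (mu_central F) (kappa_central F) (imB F) (imC F) (imA F) (imD F)
    (iota F) rfl rfl rfl (by rw [iota]; abel) d2
  have d3 : imD F = (2 : F)⁻¹ • (imC F * imA F - imA F * imC F) := by rw [b2, ← a1, imD]
  obtain ⟨-, -, -, c4⟩ := bi_identities_scaled h2 (Z F) (X F) (Y F) (mu F) (kappa F) (lam F)
    rfl rfl rfl (mu_central F) (kappa_central F) (lam_central F) (imC F) (imA F) (imB F) (imD F)
    (iota F) rfl rfl rfl (by rw [iota]; abel) d3
  simp only [RacahAlgebra.alpha, RacahAlgebra.beta, RacahAlgebra.gamma, map_add, map_sub, map_mul,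
    zA, zB, zC, zD]
  exact ⟨a4, b4, c4⟩

theorem zeta_delta (hF : ringChar F ≠ 2) :
    zeta F hF (RacahAlgebra.delta F) = (2⁻¹ ^ 2 : F) •
      ((iota F - (2 : F)⁻¹ • 1) * (iota F - (2 : F)⁻¹ • 1) - kappa F - lam F - mu F - 3
        - (iota F - (2 : F)⁻¹ • 1)) := by
  have h2 : (2 : F) ≠ 0 := Ring.two_ne_zero hF
  have zA : zeta F hF (RacahAlgebra.A F) = imA F := zeta_gen F hF _
  have zB : zeta F hF (RacahAlgebra.B F) = imB F := zeta_gen F hF _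
  have zC : zeta F hF (RacahAlgebra.C F) = imC F := zeta_gen F hF _
  have three : (3 : BIAlgebra F) = (3 : F) • 1 := by rw [Algebra.smul_def, map_ofNat, mul_one]
  rw [RacahAlgebra.delta, map_add, map_add, zA, zB, zC, imA, imB, imC,
    two_mul_sub_three_mul h2, two_mul_sub_three_mul h2, two_mul_sub_three_mul h2]
  simp only [iota, kappa, lam, mu, three, pow_two, mul_add, add_mul, mul_sub, sub_mul,
    smul_mul_assoc, mul_smul_comm, one_mul, mul_one]
  match_scalars <;> field_simp <;> ring

theorem zeta_mem_of_mem_centralSubalgebra (hF : ringChar F ≠ 2) {c : RacahAlgebra F}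
    (hc : c ∈ RacahAlgebra.centralSubalgebra F) : zeta F hF c ∈ iotaSubalgebra F := by
  have hi := iota_mem (F := F)
  have hk := kappa_mem (F := F)
  have hl := lam_mem (F := F)
  have hm := mu_mem (F := F)
  have two : (2 : BIAlgebra F) ∈ iotaSubalgebra F := ofNat_mem _ 2
  have three : (3 : BIAlgebra F) ∈ iotaSubalgebra F := ofNat_mem _ 3
  obtain ⟨ha, hb, hg⟩ := zeta_central hF
  have key : ∀ {r s : BIAlgebra F}, r ∈ iotaSubalgebra F → s ∈ iotaSubalgebra F →
      (64 : F)⁻¹ • ((2 * iota F - r - s - 3) * (r - s)) ∈ iotaSubalgebra F := fun hr hs =>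
    Subalgebra.smul_mem _ (mul_mem (sub_mem (sub_mem (sub_mem (mul_mem two hi) hr) hs) three)
      (sub_mem hr hs)) _
  have hp : iota F - (2 : F)⁻¹ • 1 ∈ iotaSubalgebra F :=
    sub_mem hi (Subalgebra.smul_mem _ (one_mem _) _)
  have hle : RacahAlgebra.centralSubalgebra F ≤ (iotaSubalgebra F).comap (zeta F hF) := by
    rw [RacahAlgebra.centralSubalgebra, Algebra.adjoin_le_iff]
    rintro _ (rfl | rfl | rfl | rfl)
    all_goals rw [SetLike.mem_coe, Subalgebra.mem_comap]
    · rw [ha]; exact key hk hm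
    · rw [hb]; exact key hl hk
    · rw [hg]; exact key hm hl
    · rw [zeta_delta]
      exact Subalgebra.smul_mem _
        (sub_mem (sub_mem (sub_mem (sub_mem (sub_mem (mul_mem hp hp) hk) hl) hm) three) hp) _
  exact hle hc

theorem zeta_D (hF : ringChar F ≠ 2) : zeta F hF (RacahAlgebra.D F) = (2⁻¹ ^ 5 : F) •
    ((X F - (2 : F)⁻¹ • 1) ^ 2 * (Y F - (2 : F)⁻¹ • 1) ^ 2
      - (Y F - (2 : F)⁻¹ • 1) ^ 2 * (X F - (2 : F)⁻¹ • 1) ^ 2) := by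
  have h2 : (2 : F) ≠ 0 := Ring.two_ne_zero hF
  refine (zeta_gen F hF _).trans ?_
  rw [zetaGen, imD, imA, imB, two_mul_sub_three_mul h2, two_mul_sub_three_mul h2]
  simp only [mul_sub, sub_mul, smul_mul_assoc, mul_smul_comm, one_mul, mul_one]
  match_scalars <;> field_simp <;> ring

theorem two_mul_iota_sub (h2 : (2 : F) ≠ 0) (r t : BIAlgebra F) :
    2 * iota F - r - t - 3 = 2 • (iota F - (2 : F)⁻¹ • 1) - (r + t + 2) := by
  have two : (2 : BIAlgebra F) = (2 : F) • 1 := by rw [Algebra.smul_def, map_ofNat, mul_one]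
  have three : (3 : BIAlgebra F) = (3 : F) • 1 := by rw [Algebra.smul_def, map_ofNat, mul_one]
  rw [two, three, smul_mul_assoc, one_mul]
  match_scalars <;> field_simp
  ring

theorem zeta_casimirBase_mem (hF : ringChar F ≠ 2) :
    zeta F hF (RacahAlgebra.casimirBase F) ∈ iotaSubalgebra F := by
  have h2 : (2 : F) ≠ 0 := Ring.two_ne_zero hF
  have h64 : (64 : F)⁻¹ = 2⁻¹ ^ 6 := by rw [inv_pow]; norm_num
  obtain ⟨k, l, m, s, hk, hl, hm, hs, h⟩ := exists_shiftedBI h2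
  have shift := two_mul_iota_sub h2
  set p := iota F - (2 : F)⁻¹ • 1 with hp
  obtain ⟨ha, hb, -⟩ := zeta_central hF
  have zA : zeta F hF (RacahAlgebra.A F) = (2⁻¹ ^ 2 : F) • ((X F - (2 : F)⁻¹ • 1) ^ 2 - 1) :=
    (zeta_gen F hF _).trans (two_mul_sub_three_mul h2 _)
  have zB : zeta F hF (RacahAlgebra.B F) = (2⁻¹ ^ 2 : F) • ((Y F - (2 : F)⁻¹ • 1) ^ 2 - 1) :=
    (zeta_gen F hF _).trans (two_mul_sub_three_mul h2 _)
  have zD := zeta_D hF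
  -- `α, β, e` are made opaque, so that the rewriting below meets no scalars from the center.
  obtain ⟨α, hα⟩ : ∃ α, α = (k - m) • (2 • p - (k + m + 2) • (1 : BIAlgebra F)) := ⟨_, rfl⟩
  obtain ⟨β, hβ⟩ : ∃ β, β = (l - k) • (2 • p - (k + l + 2) • (1 : BIAlgebra F)) := ⟨_, rfl⟩
  obtain ⟨e, he⟩ : ∃ e, e = (s - k - l - m - 3) • (1 : BIAlgebra F) - p := ⟨_, rfl⟩
  have zα : zeta F hF (RacahAlgebra.alpha F) = (2⁻¹ ^ 6 : F) • α := by
    rw [hα, ha, h64, shift, ← hk, ← hm]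
    congr 1
    have hc : (k : BIAlgebra F) - m = ((k - m : Subalgebra.center F (BIAlgebra F)) : _) := rfl
    rw [hc, Subalgebra.mem_center_iff.1 (k - m).2]
    simp only [center_smul, mul_one]
    rfl
  have zβ : zeta F hF (RacahAlgebra.beta F) = (2⁻¹ ^ 6 : F) • β := by
    rw [hβ, hb, h64, shift, ← hk, ← hl, add_comm (l : BIAlgebra F)]
    congr 1
    have hc : (l : BIAlgebra F) - k = ((l - k : Subalgebra.center F (BIAlgebra F)) : _) := rfl
    rw [hc, Subalgebra.mem_center_iff.1 (l - k).2]
    simp only [center_smul, mul_one]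
    rfl
  have zδ : zeta F hF (RacahAlgebra.delta F) = (2⁻¹ ^ 2 : F) • e := by
    rw [he, zeta_delta, ← hp, ← hs, ← hk, ← hl, ← hm]
    simp only [center_smul, mul_one]
    rfl
  rw [RacahAlgebra.casimirBase]
  simp only [map_add, map_sub, map_mul, map_pow, map_smul, map_ofNat]
  rw [casimir_rescale h2 zA zB zD zδ zα zβ, h.casimir rfl _ _ e α β rfl rfl he hα hβ]
  have hpm : p ∈ iotaSubalgebra F := sub_mem iota_mem (Subalgebra.smul_mem _ (one_mem _) _)
  have coe : ∀ c : Subalgebra.center F (BIAlgebra F), algebraMap _ (BIAlgebra F) c = c := by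
    intro c
    rw [Algebra.algebraMap_eq_smul_one, center_smul, mul_one]
  exact Subalgebra.smul_mem _ (casimirCoeff_mem (iotaSubalgebra F).toSubring
    (by rw [coe, hk]; exact kappa_mem) (by rw [coe, hl]; exact lam_mem)
    (by rw [coe, hm]; exact mu_mem) (by rw [coe, hs]; exact mul_mem hpm hpm) hpm) _

end BIAlgebra

theorem theorem6p8 {F : Type*} [Field F] (hF : ringChar F ≠ 2) (Ω : RacahAlgebra F)
    (hΩ : RacahAlgebra.IsCasimir Ω) :
    ∃! P : MvPolynomial (Fin 4) F,
      zeta F hF Ω =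
        evalFour P (BIAlgebra.iota F) (BIAlgebra.kappa F) (BIAlgebra.lam F) (BIAlgebra.mu F) := by
  obtain ⟨c, hc, rfl⟩ := hΩ
  have hmem : zeta F hF (RacahAlgebra.casimirBase F + c) ∈ BIAlgebra.iotaSubalgebra F := by
    rw [map_add]
    exact add_mem (BIAlgebra.zeta_casimirBase_mem hF)
      (BIAlgebra.zeta_mem_of_mem_centralSubalgebra hF hc)
  obtain ⟨P, hP⟩ := BIAlgebra.exists_evalFour_of_mem hmem
  exact ⟨P, hP, fun Q hQ =>
    BIAlgebra.evalFour_injective (Ring.two_ne_zero hF) (hQ.symm.trans hP)⟩
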